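/- Let $N,m$ be positive integers and $\mathbb T^N=\mathbb R^N/\mathbb Z^N$. For $i=1,\dots,m$ let $H_i:\mathbb T^N\times\mathbb R^N\to\mathbb R$ be continuous and such that, for every $x\in\mathbb T^N$, the function $p\mapsto H_i(x,p)$ is convex and superlinear (that is, $H_i(x,p)/|p|\to+\infty$ as $|p|\to+\infty$), and let $L_i(x,q)=\sup_{p\in\mathbb R^N}\{p\cdot q-H_i(x,p)\}$. Let $A=(a_{ij})$ be a real $m\times m$ matrix with $a_{ij}\le 0$ for $i\ne j$, with $\sum_{j=1}^m a_{ij}=0$ for every $i$, and irreducible: for every nonempty $W\subsetneq\{1,\dots,m\}$ there are $i\in W$ and $j\notin W$ with $a_{ij}<0$. For $\alpha\in\mathbb R$ consider the system $$H_i(x,Du_i)+\sum_{j=1}^m a_{ij}u_j(x)=\alpha\quad\text{in }\mathbb T^N,\qquad i=1,\dots,m. \tag{HJ$\alpha$}$$ A continuous function $\mathbf u=(u_1,\dots,u_m):\mathbb T^N\to\mathbb R^m$ is a subsolution (respectively, supersolution) of (HJ$\alpha$) if for all $x$ and $i$ one has $H_i(x,p)+\sum_j a_{ij}u_j(x)\le\alpha$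 for every $p\in D^+u_i(x)$ (respectively, $\ge\alpha$ for every $p\in D^-u_i(x)$), and a solution if it is both. Here $D^+f(x)$ (respectively, $D^-f(x)$) is the set of the differentials at $x$ of the $C^1$ functions $\phi$ with $\phi(x)=f(x)$ and $\phi\ge f$ (respectively, $\phi\le f$) near $x$. Let $\beta$ be the critical value, that is, the least $\alpha$ for which (HJ$\alpha$) admits subsolutions. A critical solution is a solution of (HJ$\alpha$) with $\alpha=\beta$. Proposition 4.4. Let $\mathbf u$ be a critical solution, $x\in\mathbb T^N$ and $i\in\{1,\dots,m\}$. Then there is a curve $\gamma:(-\infty,0]\to\mathbb T^N$, absolutely continuous on every compact interval, with $\gamma(0)=x$, such that for a.e. $t\in(-\infty,0)$ both $\gamma$ and $u_i\circ\gamma$ are differentiable at $t$ and $$\frac{d}{dt}u_i(\gamma(t))=L_i(\gamma(t),\dot\gamma(t))-\sum_{j=1}^m a_{ij}u_j(\gamma(t))+\beta .$$ In other words, $\gamma$ is a calibrating curve: for all $a\le b\le 0$ the right-hand side is integrable on $[a,b]$ and $$u_i(\gamma(b))-u_i(\gamma(a))=\int_a^b\Big(L_i(\gamma(t),\dot\gamma(t))-\sum_{j=1}^m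 a_{ij}u_j(\gamma(t))+\beta\Big)\,dt .$$ -/

import Mathlib

open Set Filter Topology MeasureTheory

noncomputable section

/-- The Euclidean space `ℝ^N`. -/
abbrev RSpace (N : ℕ) : Type := EuclideanSpace ℝ (Fin N)

/-- The flat torus `𝕋^N = ℝ^N / ℤ^N`. -/
abbrev Torus (N : ℕ) : Type := UnitAddTorus (Fin N)

/-- The canonical projection `ℝ^N → 𝕋^N`. -/
def torusProj {N : ℕ} (v : RSpace N) : Torus N := fun k => ((v k : ℝ) : UnitAddCircle)

/-- The superdifferential `D⁺f(x)`: the differentials at `x` of the `C¹` functions that agree with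
`f` at `x` and are `≥ f` near `x`. Functions near `x` are read in the chart `h ↦ x + torusProj h`
of the torus centred at `x`. -/
def superDiff {N : ℕ} (f : Torus N → ℝ) (x : Torus N) : Set (RSpace N) :=
  {p | ∃ φ : RSpace N → ℝ, ContDiff ℝ 1 φ ∧ φ 0 = f x ∧
    (∀ᶠ h in 𝓝 (0 : RSpace N), f (x + torusProj h) ≤ φ h) ∧ HasGradientAt φ p 0}

/-- The subdifferential `D⁻f(x)`: the differentials at `x` of the `C¹` functions that agree with
`f` at `x` and are `≤ f` near `x`. -/
def subDiff {N : ℕ} (f : Torus N → ℝ) (x : Torus N) : Set (RSpace N) :=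
  {p | ∃ φ : RSpace N → ℝ, ContDiff ℝ 1 φ ∧ φ 0 = f x ∧
    (∀ᶠ h in 𝓝 (0 : RSpace N), φ h ≤ f (x + torusProj h)) ∧ HasGradientAt φ p 0}

/-- Continuous viscosity subsolutions of the system
`H_i(x, Du_i) + ∑_j a_ij u_j(x) = α` on `𝕋^N`, `i = 1, …, m`. -/
def IsSubsolution {N m : ℕ} (H : Fin m → Torus N → RSpace N → ℝ) (A : Matrix (Fin m) (Fin m) ℝ)
    (α : ℝ) (u : Torus N → Fin m → ℝ) : Prop :=
  Continuous u ∧ ∀ (x : Torus N) (i : Fin m), ∀ p ∈ superDiff (fun y => u y i) x,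
    H i x p + ∑ j, A i j * u x j ≤ α

/-- Continuous viscosity supersolutions of the same system. -/
def IsSupersolution {N m : ℕ} (H : Fin m → Torus N → RSpace N → ℝ) (A : Matrix (Fin m) (Fin m) ℝ)
    (α : ℝ) (u : Torus N → Fin m → ℝ) : Prop :=
  Continuous u ∧ ∀ (x : Torus N) (i : Fin m), ∀ p ∈ subDiff (fun y => u y i) x,
    α ≤ H i x p + ∑ j, A i j * u x j

/-- Viscosity solutions of the same system. -/
def IsSolution {N m : ℕ} (H : Fin m → Torus N → RSpace N → ℝ) (A : Matrix (Fin m) (Fin m) ℝ)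
    (α : ℝ) (u : Torus N → Fin m → ℝ) : Prop :=
  IsSubsolution H A α u ∧ IsSupersolution H A α u

/-- The critical value `β`: the least `α` for which the system admits subsolutions. -/
def criticalValue {N m : ℕ} (H : Fin m → Torus N → RSpace N → ℝ)
    (A : Matrix (Fin m) (Fin m) ℝ) : ℝ :=
  sInf {α : ℝ | ∃ u : Torus N → Fin m → ℝ, IsSubsolution H A α u}

/-- A critical solution: a viscosity solution of the system with `α` the critical value. -/
def IsCriticalSolution {N m : ℕ} (H : Fin m → Torus N → RSpace N → ℝ)
    (A : Matrix (Fin m) (Fin m) ℝ) (u : Torus N → Fin m → ℝ) : Prop :=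
  IsSolution H A (criticalValue H A) u

/-- Superlinearity of a function on `ℝ^N`: `h(p) / |p| → +∞` as `|p| → +∞`. -/
def Superlinear {N : ℕ} (h : RSpace N → ℝ) : Prop :=
  Tendsto (fun p => h p / ‖p‖) (Bornology.cobounded (RSpace N)) atTop

/-- The Fenchel transform in the momentum: `L(x, q) = sup_p (p · q - H(x, p))`. -/
def lagrangian {N : ℕ} (H : Torus N → RSpace N → ℝ) (x : Torus N) (q : RSpace N) : ℝ :=
  ⨆ p : RSpace N, (inner ℝ p q - H x p)

/-- The supremum defining the Lagrangian of a continuous superlinear Hamiltonian is finite. -/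
theorem lagrangian_bddAbove {N : ℕ} (H : Torus N → RSpace N → ℝ) (x : Torus N) (q : RSpace N)
    (hc : Continuous (H x)) (hs : Superlinear (H x)) :
    BddAbove (range fun p : RSpace N => inner ℝ p q - H x p) := by
  have h1 : ∀ᶠ p in Bornology.cobounded (RSpace N), ‖q‖ ≤ H x p / ‖p‖ :=
    hs.eventually_ge_atTop ‖q‖
  have h2 : ∀ᶠ p in Bornology.cobounded (RSpace N), 1 ≤ ‖p‖ :=
    tendsto_norm_cobounded_atTop.eventually_ge_atTop 1
  have h3 := h1.and h2
  rw [Metric.cobounded_eq_cocompact, Filter.Eventually, mem_cocompact] at h3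
  obtain ⟨K, hK, hKs⟩ := h3
  obtain ⟨C, hC⟩ := hK.bddAbove_image
    (f := fun p : RSpace N => inner ℝ p q - H x p) (by fun_prop)
  refine ⟨max C 0, ?_⟩
  rintro _ ⟨p, rfl⟩
  by_cases hp : p ∈ K
  · exact le_max_of_le_left (hC ⟨p, hp, rfl⟩)
  · obtain ⟨h4, h5⟩ := hKs hp
    rw [le_div_iff₀ (by linarith)] at h4
    have h6 := real_inner_le_norm p q
    exact le_max_of_le_right (by simp only; linarith [mul_comm ‖p‖ ‖q‖])

/-- The curve `γ` in the torus is differentiable at time `t` with `γ̇(t) = q`: near `t` it is the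
projection of a curve in `ℝ^N` whose derivative at `t` is `q`. -/
def HasVelocityAt {N : ℕ} (γ : ℝ → Torus N) (q : RSpace N) (t : ℝ) : Prop :=
  ∃ η : ℝ → RSpace N, (∀ᶠ s in 𝓝 t, γ s = torusProj (η s)) ∧ HasDerivAt η q t

/-- An absolutely continuous curve `γ : (-∞, 0] → 𝕋^N` (absolutely continuous on each compact
interval `[a, 0]`); the values of `γ` at positive times are irrelevant. -/
def IsACCurve {N : ℕ} (γ : ℝ → Torus N) : Prop :=
  ∀ a : ℝ, a ≤ 0 → AbsolutelyContinuousOnInterval γ a 0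

/-- The quantity `L_i(y, q) - ∑_j a_ij u_j(y) + β`, with `β` the critical value. -/
def calibrationIntegrand {N m : ℕ} (H : Fin m → Torus N → RSpace N → ℝ)
    (A : Matrix (Fin m) (Fin m) ℝ) (u : Torus N → Fin m → ℝ) (i : Fin m)
    (y : Torus N) (q : RSpace N) : ℝ :=
  lagrangian (H i) y q - ∑ j, A i j * u y j + criticalValue H A

end

/-! Freezing the coupling into the continuous potential `V = ∑ j, A i j * u j - β` makes `u_i` a
viscosity solution of the scalar equation `F = H_i + V = 0`, so a scalar statement on the lift to
`ℝ^N` suffices.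

Subsolution side: proximal supergradients satisfy `F ≤ 0`, so coercivity bounds them; the function
is then Lipschitz, and its growth along segments is bounded by their slopes
(`sub_le_of_proxSuper_slope_le`).

Supersolution side: a proximal subgradient `p` satisfies `F z p ≥ 0`, so an approximate subgradient
`q` of `F z` at `p` has Fenchel transform at most `⟪p, q⟫ + e`. Euler steps along `-q`, with `p`
read off an inf-convolution, decrease the function almost optimally; their limit is a Lipschitz
descent curve (`exists_descent_curve`).

At a time where the curve and the function along it are differentiable, descent gives one inequality
between derivative and Lagrangian, and the subsolution property gives the other
(`isLUB_of_descent_curve`). Reversing time gives the calibrated curve, and Rademacher covers almost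
every time. -/

/-! ### Proximal gradients, quadratic convolutions and approximate convex subgradients. -/

section Proximal

variable {E : Type*} [NormedAddCommGroup E] [InnerProductSpace ℝ E]

/-- `p` is a proximal supergradient of `f` at `z`, with a global quadratic majorant. -/
def IsProxSuper (f : E → ℝ) (z p : E) : Prop :=
  ∃ c : ℝ, ∀ y, f y ≤ f z + inner ℝ p (y - z) + c * ‖y - z‖ ^ 2

/-- `p` is a proximal subgradient of `f` at `z`, with a global quadratic minorant. -/
def IsProxSub (f : E → ℝ) (z p : E) : Prop :=
  ∃ c : ℝ, ∀ y, f z + inner ℝ p (y - z) - c * ‖y - z‖ ^ 2 ≤ f y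

theorem isProxSuper_neg {f : E → ℝ} {z p : E} (h : IsProxSuper (fun y => -f y) z (-p)) :
    IsProxSub f z p := by
  obtain ⟨c, hc⟩ := h
  refine ⟨c, fun y => ?_⟩
  have := hc y
  rw [inner_neg_left] at this
  linarith

theorem norm_add_smul_sq (a b : E) (t : ℝ) :
    ‖a + t • b‖ ^ 2 = ‖a‖ ^ 2 + 2 * t * inner ℝ a b + t ^ 2 * ‖b‖ ^ 2 := by
  rw [norm_add_sq_real, inner_smul_right, norm_smul, mul_pow, Real.norm_eq_abs, sq_abs]
  ring

/-- The supremum defining the quadratic sup-convolution of a bounded continuous function is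
attained, at a point carrying a proximal supergradient. -/
theorem exists_supConv_max [ProperSpace E] {f : E → ℝ} (hf : Continuous f) {B : ℝ}
    (hB : ∀ y, |f y| ≤ B) {c : ℝ} (hc : 0 < c) (y : E) :
    ∃ z, (∀ z', f z' - c * ‖z' - y‖ ^ 2 ≤ f z - c * ‖z - y‖ ^ 2) ∧
      c * ‖z - y‖ ^ 2 ≤ 2 * B ∧ IsProxSuper f z ((2 * c) • (z - y)) := by
  have hB0 : 0 ≤ B := (abs_nonneg _).trans (hB y)
  -- Outside this radius the penalty exceeds `2 * B`, the largest possible gain in `f`, so the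
  -- maximum over the ball is global.
  set r : ℝ := Real.sqrt (2 * B / c) with hr
  have hr2 : c * r ^ 2 = 2 * B := by
    rw [hr, Real.sq_sqrt (by positivity)]; field_simp
  have hr0 : 0 ≤ r := Real.sqrt_nonneg _
  obtain ⟨z, -, hmax⟩ := (isCompact_closedBall y r).exists_isMaxOn
    ⟨y, Metric.mem_closedBall_self hr0⟩
    (f := fun z => f z - c * ‖z - y‖ ^ 2) (by fun_prop)
  have hyz : f y ≤ f z - c * ‖z - y‖ ^ 2 := by
    simpa using hmax (Metric.mem_closedBall_self hr0)
  have hall : ∀ z', f z' - c * ‖z' - y‖ ^ 2 ≤ f z - c * ‖z - y‖ ^ 2 := by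
    intro z'
    by_cases hz : z' ∈ Metric.closedBall y r
    · exact hmax hz
    · rw [Metric.mem_closedBall, not_le, dist_eq_norm] at hz
      have : r ^ 2 ≤ ‖z' - y‖ ^ 2 := by gcongr
      have h2 := mul_le_mul_of_nonneg_left this hc.le
      have h3 := (abs_le.1 (hB z')).2
      have h4 := (abs_le.1 (hB y)).1
      linarith
  refine ⟨z, hall, ?_, c, fun z' => ?_⟩
  · have h3 := (abs_le.1 (hB z)).2
    have h4 := (abs_le.1 (hB y)).1
    linarith
  · have h1 := hall z'
    have h2 : ‖z' - y‖ ^ 2 = ‖z - y‖ ^ 2 + 2 * inner ℝ (z - y) (z' - z) + ‖z' - z‖ ^ 2 := by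
      have := norm_add_sq_real (z - y) (z' - z)
      rwa [show z - y + (z' - z) = z' - y by abel] at this
    rw [h2] at h1
    rw [real_inner_smul_left]
    linarith

/-- The infimum defining the quadratic inf-convolution of a bounded continuous function is
attained, at a point carrying a proximal subgradient. -/
theorem exists_infConv_min [ProperSpace E] {f : E → ℝ} (hf : Continuous f) {B : ℝ}
    (hB : ∀ y, |f y| ≤ B) {c : ℝ} (hc : 0 < c) (y : E) :
    ∃ z, (∀ z', f z + c * ‖z - y‖ ^ 2 ≤ f z' + c * ‖z' - y‖ ^ 2) ∧
      IsProxSub f z ((2 * c) • (y - z)) := by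
  obtain ⟨z, h1, -, h3⟩ := exists_supConv_max (f := fun y => -f y) hf.neg (B := B)
    (by simpa using hB) hc y
  refine ⟨z, fun z' => by have := h1 z'; linarith, isProxSuper_neg ?_⟩
  rwa [← smul_neg, neg_sub]

/-- Growth along a segment is controlled by the slopes of the proximal supergradients at nearby
points. -/
theorem sub_le_of_proxSuper_slope_le [ProperSpace E] {f : E → ℝ} (hf : Continuous f) {B : ℝ}
    (hB : ∀ y, |f y| ≤ B) (x q : E) {C δ ρ : ℝ} (hδ : 0 ≤ δ) (hρ : 0 < ρ)
    (h : ∀ z p, (∃ s ∈ Icc 0 δ, ‖z - (x + s • q)‖ ≤ ρ) → IsProxSuper f z p → inner ℝ p q ≤ C) :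
    f (x + δ • q) - f x ≤ δ * C := by
  have hB0 : 0 ≤ B := (abs_nonneg _).trans (hB x)
  apply le_of_forall_pos_le_add
  intro e he
  obtain ⟨r, hr, hrf⟩ := Metric.continuous_iff.1 hf x e he
  -- `c` will force maximizers within `r'` of their base point: `ρ` makes the slope bound applicable
  -- there, `r / 2` keeps `f (Z x)` within `e` of `f x`.
  set r' := min ρ (r / 2) with hr'
  have hr'0 : 0 < r' := by positivity
  set c : ℝ := 2 * B / r' ^ 2 + 1 with hc
  have hc0 : 0 < c := by positivity
  have hcr : 2 * B ≤ c * r' ^ 2 := by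
    rw [hc, add_mul, div_mul_cancel₀ _ (by positivity)]; nlinarith [sq_nonneg r']
  choose Z hZ1 hZ2 hZ3 using exists_supConv_max hf hB hc0
  have hZr : ∀ y, ‖Z y - y‖ ≤ r' := by
    intro y
    have h1 : c * ‖Z y - y‖ ^ 2 ≤ c * r' ^ 2 := (hZ2 y).trans hcr
    exact le_of_sq_le_sq (le_of_mul_le_mul_left h1 hc0) hr'0.le
  set g : E → ℝ := fun y => f (Z y) - c * ‖Z y - y‖ ^ 2 with hg
  -- The maximizer at `y` competes in the sup-convolution at the previous point. The error is
  -- quadratic in `k`, so `n` steps of length `δ / n` cost only `O(1 / n)`.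
  have step : ∀ s ∈ Icc 0 δ, ∀ k : ℝ, 0 ≤ k →
      g (x + s • q) ≤ g (x + (s - k) • q) + (k * C + c * k ^ 2 * ‖q‖ ^ 2) := by
    intro s hs k hk
    set y := x + s • q with hy
    have h1 := hZ1 (x + (s - k) • q) (Z y)
    have h2 : Z y - (x + (s - k) • q) = (Z y - y) + k • q := by
      rw [hy, sub_smul]; abel
    rw [h2, norm_add_smul_sq] at h1
    have h3 := h (Z y) _ ⟨s, hs, (hZr y).trans (min_le_left _ _)⟩ (hZ3 y)
    rw [real_inner_smul_left] at h3
    have h4 := mul_le_mul_of_nonneg_left h3 hk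
    simp only [hg]
    linarith
  have iter : ∀ n : ℕ, 0 < n →
      g (x + δ • q) ≤ g x + (δ * C + c * δ ^ 2 * ‖q‖ ^ 2 / n) := by
    intro n hn
    have hn' : (0 : ℝ) < n := by exact_mod_cast hn
    have : ∀ k : ℕ, k ≤ n → g (x + (k * (δ / n)) • q) ≤
        g x + k * ((δ / n) * C + c * (δ / n) ^ 2 * ‖q‖ ^ 2) := by
      intro k
      induction k with
      | zero => intro _; simp
      | succ k ih =>
        intro hk
        have h1 := ih (by omega)
        have hk' : ((k + 1 : ℕ) : ℝ) ≤ n := by exact_mod_cast hk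
        have h2 := step ((k + 1 : ℕ) * (δ / n)) ⟨by positivity, by
          calc ((k + 1 : ℕ) : ℝ) * (δ / n) ≤ n * (δ / n) := by gcongr
            _ = δ := by field_simp⟩ (δ / n) (by positivity)
        rw [show ((k + 1 : ℕ) : ℝ) * (δ / n) - δ / n = k * (δ / n) by push_cast; ring] at h2
        push_cast at h2 ⊢
        linarith
    have h1 := this n le_rfl
    rw [show (n : ℝ) * (δ / n) = δ by field_simp] at h1
    refine h1.trans (le_of_eq ?_)
    field_simp
  have lim : g (x + δ • q) ≤ g x + (δ * C + 0) := by
    refine ge_of_tendsto (x := atTop) (f := fun n : ℕ => g x + (δ * C + c * δ ^ 2 * ‖q‖ ^ 2 / n)) ?_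
      (eventually_atTop.2 ⟨1, fun n hn => iter n (by omega)⟩)
    exact tendsto_const_nhds.add (tendsto_const_nhds.add (tendsto_const_div_atTop_nhds_zero_nat _))
  have h1 : f (x + δ • q) ≤ g (x + δ • q) := by
    have := hZ1 (x + δ • q) (x + δ • q)
    simpa using this
  have h2 : g x ≤ f (Z x) := by
    simp only [hg]; nlinarith [sq_nonneg ‖Z x - x‖]
  have h3 : f (Z x) - f x ≤ e := by
    have := hrf (Z x) (by
      rw [dist_eq_norm]
      have h5 := (hZr x).trans (min_le_right _ _)
      linarith)
    rw [Real.dist_eq] at this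
    exact (le_abs_self _).trans this.le
  linarith

/-- A bounded continuous function with bounded proximal supergradients is Lipschitz. -/
theorem abs_sub_le_of_proxSuper_norm_le [ProperSpace E] {f : E → ℝ} (hf : Continuous f) {B : ℝ}
    (hB : ∀ y, |f y| ≤ B) {K : ℝ} (h : ∀ z p, IsProxSuper f z p → ‖p‖ ≤ K) (x y : E) :
    |f x - f y| ≤ K * ‖x - y‖ := by
  have key : ∀ a b : E, f b - f a ≤ K * ‖b - a‖ := by
    intro a b
    have := sub_le_of_proxSuper_slope_le hf hB a (b - a) (C := K * ‖b - a‖) (δ := 1) (ρ := 1)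
      zero_le_one one_pos (fun z p _ hp =>
        (real_inner_le_norm _ _).trans (mul_le_mul_of_nonneg_right (h z p hp) (norm_nonneg _)))
    simpa using this
  rw [abs_le]
  constructor
  · have := key x y
    rw [norm_sub_rev] at this
    linarith
  · exact key y x

/-- Proximal subgradients of a Lipschitz function are bounded by its Lipschitz constant. -/
theorem IsProxSub.norm_le {f : E → ℝ} {K : ℝ} (hK : 0 ≤ K)
    (h : ∀ x y, |f x - f y| ≤ K * ‖x - y‖) {z p : E} (hp : IsProxSub f z p) : ‖p‖ ≤ K := by
  obtain ⟨c, hc⟩ := hp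
  by_contra! hlt
  have hp0 : 0 < ‖p‖ := hK.trans_lt hlt
  -- Test the quadratic minorant at `z + t • p`, divide by `t * ‖p‖`, then let `t` tend to `0`.
  have key : ∀ t : ℝ, 0 < t → ‖p‖ - K ≤ t * (c * ‖p‖) := by
    intro t ht
    have h1 := hc (z + t • p)
    have h2 := (abs_le.1 (h (z + t • p) z)).2
    rw [add_sub_cancel_left, norm_smul, Real.norm_of_nonneg ht.le] at h1 h2
    rw [real_inner_smul_right, real_inner_self_eq_norm_sq] at h1
    have h3 : t * ‖p‖ * (‖p‖ - K) ≤ t * ‖p‖ * (t * (c * ‖p‖)) := by nlinarith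
    exact le_of_mul_le_mul_left h3 (by positivity)
  have lim : Tendsto (fun t : ℝ => t * (c * ‖p‖)) (𝓝[>] 0) (𝓝 (0 * (c * ‖p‖))) :=
    (tendsto_id.mul_const _).mono_left nhdsWithin_le_nhds
  have := ge_of_tendsto lim (eventually_mem_nhdsWithin.mono fun t ht => key t ht)
  linarith

/-- A continuous convex function has approximate subgradients, bounded by its local oscillation. -/
theorem exists_approx_subgradient [CompleteSpace E] {φ : E → ℝ} (hφ : ConvexOn ℝ univ φ)
    (hc : Continuous φ) {p : E} {M : ℝ} (hM : ∀ p', ‖p' - p‖ ≤ 1 → |φ p'| ≤ M)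
    (h0 : 0 ≤ φ p) {e : ℝ} (he : 0 < e) (he1 : e ≤ 1) :
    ∃ q : E, ‖q‖ ≤ 2 * M + 1 ∧ ∀ p', inner ℝ q p' - φ p' ≤ inner ℝ p q + e := by
  obtain ⟨l, c, h1, h2⟩ := hφ.exists_affine_le_of_lt (𝕜 := ℝ) (mem_univ p)
    (show φ p - e < φ p by linarith) isClosed_univ (hc.lowerSemicontinuous.lowerSemicontinuousOn _)
  obtain ⟨q, rfl⟩ := (InnerProductSpace.toDual ℝ E).surjective l
  have h1' : ∀ p', inner ℝ q p' + c ≤ φ p' := fun p' => by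
    simpa using h1 ⟨p', mem_univ _⟩
  have h2' : φ p - e ≤ inner ℝ q p + c := by
    simpa using h2.ge
  refine ⟨q, ?_, fun p' => ?_⟩
  · have hM0 : 0 ≤ M := (abs_nonneg _).trans (hM p (by simp))
    rcases eq_or_ne q 0 with rfl | hq
    · simp; positivity
    have hq' : 0 < ‖q‖ := norm_pos_iff.2 hq
    -- A unit step from `p` in the direction of `q` raises the affine minorant by `‖q‖`, which `M`
    -- must absorb.
    have h3 := h1' (p + ‖q‖⁻¹ • q)
    rw [inner_add_right, real_inner_smul_right, real_inner_self_eq_norm_sq,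
      show ‖q‖⁻¹ * ‖q‖ ^ 2 = ‖q‖ by field_simp] at h3
    have h4 := (abs_le.1 (hM (p + ‖q‖⁻¹ • q) (by
      rw [add_sub_cancel_left, norm_smul, norm_inv, norm_norm, inv_mul_cancel₀ hq'.ne']))).2
    linarith
  -- The affine minorant bounds the left side by `-c ≤ ⟪q, p⟫ - φ p + e`, and `φ p ≥ 0` removes the
  -- middle term.
  · have := h1' p'
    rw [real_inner_comm p q] at *
    linarith

end Proximal

/-! ### Descent curves as limits of Euler schemes. -/

section Descent

variable {E : Type*} [NormedAddCommGroup E] [InnerProductSpace ℝ E]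

/-- A discrete descent trajectory for `f` along approximate subgradients of `F` in the momentum,
obtained from the quadratic inf-convolution with parameter `c`, with time step `h`. -/
theorem exists_discrete_descent [ProperSpace E] {f : E → ℝ} (hf : Continuous f) {B : ℝ}
    (hB : ∀ y, |f y| ≤ B) {K : ℝ} (hK : 0 ≤ K) (hfK : ∀ x y, |f x - f y| ≤ K * ‖x - y‖)
    {F : E → E → ℝ} {R : ℝ} {e : ℝ}
    (hq : ∀ z p, IsProxSub f z p → ∃ q : E, ‖q‖ ≤ R ∧
      ∀ p', inner ℝ q p' - F z p' ≤ inner ℝ p q + e)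
    (x : E) {c h : ℝ} (hc : 0 < c) (hh : 0 ≤ h) :
    ∃ y : ℕ → E, y 0 = x ∧ (∀ k, ‖y (k + 1) - y k‖ ≤ h * R) ∧
      ∀ k l, k ≤ l → ∀ p' C,
        (∀ z, (∃ j, k ≤ j ∧ j < l ∧ ‖z - y j‖ ≤ K / (2 * c)) → F z p' ≤ C) →
        f (y l) - f (y k) ≤ K ^ 2 / (2 * c) + inner ℝ p' (y l - y k) +
          ((l : ℝ) - k) * h * (C + (e + c * h * R ^ 2)) := by
  choose Z hZ1 hZ2 using exists_infConv_min hf hB hc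
  have hp : ∀ y, ‖(2 * c) • (y - Z y)‖ ≤ K := fun y => (hZ2 y).norm_le hK hfK
  have hZr : ∀ y, ‖Z y - y‖ ≤ K / (2 * c) := by
    intro y
    have := hp y
    rw [norm_smul, Real.norm_of_nonneg (by positivity), norm_sub_rev] at this
    rw [le_div_iff₀ (by positivity)]
    linarith
  choose Q hQ1 hQ2 using fun y => hq (Z y) _ (hZ2 y)
  set g : E → ℝ := fun y => f (Z y) + c * ‖Z y - y‖ ^ 2 with hg
  set y : ℕ → E := fun k => (fun v => v - h • Q v)^[k] x with hy
  have hys : ∀ k, y (k + 1) = y k - h • Q (y k) := by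
    intro k; simp only [hy, Function.iterate_succ', Function.comp]
  -- The old minimizer `Z v` competes at the moved point, so `g` drops by `h * ⟪p, Q v⟫` up to `c *
  -- h ^ 2 * R ^ 2`; `hQ2` then trades this drop for the Fenchel bound at an arbitrary `p'`.
  have step : ∀ v p', g (v - h • Q v) ≤ g v + (inner ℝ p' (v - h • Q v - v) +
      h * (F (Z v) p' + (e + c * h * R ^ 2))) := by
    intro v p'
    have h1 := hZ1 (v - h • Q v) (Z v)
    rw [show Z v - (v - h • Q v) = (Z v - v) + h • Q v by abel, norm_add_smul_sq] at h1
    have h2 := mul_le_mul_of_nonneg_left (hQ2 v p') hh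
    rw [real_inner_smul_left, ← neg_sub (Z v) v, inner_neg_left] at h2
    have h3 : ‖Q v‖ ^ 2 ≤ R ^ 2 := by have := hQ1 v; gcongr
    have h4 := mul_le_mul_of_nonneg_left h3 (show 0 ≤ c * h ^ 2 by positivity)
    rw [show v - h • Q v - v = -(h • Q v) by abel, inner_neg_right, real_inner_smul_right,
      real_inner_comm (Q v) p']
    simp only [hg]
    linarith
  refine ⟨y, rfl, fun k => ?_, fun k l hkl p' C hC => ?_⟩
  · rw [hys, sub_sub_cancel_left, norm_neg, norm_smul, Real.norm_of_nonneg hh]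
    exact mul_le_mul_of_nonneg_left (hQ1 _) hh
  · have iter : ∀ n, k + n ≤ l → g (y (k + n)) ≤ g (y k) + (inner ℝ p' (y (k + n) - y k) +
        n * h * (C + (e + c * h * R ^ 2))) := by
      intro n
      induction n with
      | zero => intro _; simp
      | succ n ih =>
        intro hn
        have h1 := ih (by omega)
        have h2 := step (y (k + n)) p'
        rw [← hys] at h2
        have h3 := mul_le_mul_of_nonneg_left
          (hC (Z (y (k + n))) ⟨k + n, by omega, by omega, hZr _⟩) hh
        have h4 : (inner ℝ p' (y (k + n + 1) - y k) : ℝ) =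
            inner ℝ p' (y (k + n + 1) - y (k + n)) + inner ℝ p' (y (k + n) - y k) := by
          rw [← inner_add_right, sub_add_sub_cancel]
        rw [← add_assoc, h4]
        push_cast
        linarith
    have h1 := iter (l - k) (by omega)
    rw [show k + (l - k) = l by omega, Nat.cast_sub hkl] at h1
    have h2 : g (y k) ≤ f (y k) := by simpa using hZ1 (y k) (y k)
    have h3 : f (y l) ≤ g (y l) + K ^ 2 / (2 * c) := by
      have h4 := (abs_le.1 (hfK (y l) (Z (y l)))).2
      have h5 := mul_le_mul_of_nonneg_left (hZr (y l)) hK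
      rw [norm_sub_rev] at h4
      have h6 : K * (K / (2 * c)) = K ^ 2 / (2 * c) := by ring
      have h7 : 0 ≤ c * ‖Z (y l) - y l‖ ^ 2 := by positivity
      simp only [hg]
      linarith
    linarith

/-- A Lipschitz descent curve for `f` issued from `x`, obtained as a limit of discrete ones. -/
theorem exists_descent_curve [ProperSpace E] {f : E → ℝ} (hf : Continuous f) {B : ℝ}
    (hB : ∀ y, |f y| ≤ B) {K : ℝ} (hK : 0 ≤ K) (hfK : ∀ x y, |f x - f y| ≤ K * ‖x - y‖)
    {F : E → E → ℝ} {R : ℝ}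
    (hq : ∀ z p, IsProxSub f z p → ∀ e, 0 < e → e ≤ 1 → ∃ q : E, ‖q‖ ≤ R ∧
      ∀ p', inner ℝ q p' - F z p' ≤ inner ℝ p q + e) (x : E) :
    ∃ γ : ℝ → E, γ 0 = x ∧ (∀ s t, 0 ≤ s → 0 ≤ t → ‖γ t - γ s‖ ≤ R * |t - s|) ∧
      ∀ s t, 0 ≤ s → s ≤ t → ∀ p' C ρ, 0 < ρ →
        (∀ z, ‖z - γ s‖ ≤ R * (t - s) + ρ → F z p' ≤ C) →
        f (γ t) - f (γ s) ≤ inner ℝ p' (γ t - γ s) + (t - s) * C := by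
  have hdisc : ∀ n : ℕ, _ := fun n => exists_discrete_descent hf hB hK hfK
    (e := 1 / ((n : ℝ) + 1))
    (fun z p hp => hq z p hp (1 / ((n : ℝ) + 1)) (by positivity)
      (by rw [div_le_one (by positivity)]; linarith [n.cast_nonneg (α := ℝ)])) x
    -- The errors involve `1 / c` and `c * h`; with this scaling both equal `1 / (n + 1)`.
    (c := (n : ℝ) + 1) (h := 1 / ((n : ℝ) + 1) ^ 2) (by positivity) (by positivity)
  choose y hy0 hyR hyF using hdisc
  set h : ℕ → ℝ := fun n => 1 / ((n : ℝ) + 1) ^ 2 with hh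
  have hh0 : ∀ n, 0 < h n := fun n => by simp only [hh]; positivity
  set k : ℕ → ℝ → ℕ := fun n t => ⌊t * ((n : ℝ) + 1) ^ 2⌋₊ with hk
  have hsq : Tendsto (fun n : ℕ => ((n : ℝ) + 1) ^ 2) atTop atTop :=
    (tendsto_pow_atTop two_ne_zero).comp
      (tendsto_atTop_add_const_right _ _ tendsto_natCast_atTop_atTop)
  have hkt : ∀ t, 0 ≤ t → Tendsto (fun n => (k n t : ℝ) * h n) atTop (𝓝 t) := by
    intro t ht
    have := (tendsto_nat_floor_mul_div_atTop ht).comp hsq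
    refine this.congr fun n => ?_
    simp [hk, hh, div_eq_mul_inv]
  have hkmono : ∀ n s t, s ≤ t → k n s ≤ k n t := fun n s t hst => by
    simp only [hk]; gcongr
  have hyL : ∀ n a b, a ≤ b → ‖y n b - y n a‖ ≤ R * ((b : ℝ) * h n - a * h n) := by
    intro n a b hab
    induction b, hab using Nat.le_induction with
    | base => simp
    | succ b hab ih =>
      have h1 := hyR n b
      have h2 := norm_sub_le_norm_sub_add_norm_sub (y n (b + 1)) (y n b) (y n a)
      push_cast
      have h3 : (1 / ((n : ℝ) + 1) ^ 2) = h n := rfl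
      rw [h3] at h1
      linarith
  -- An ultrafilter gives limits at all times at once, in place of an Arzelà–Ascoli extraction.
  set U : Ultrafilter ℕ := hyperfilter ℕ with hU
  have hUle : (U : Filter ℕ) ≤ atTop := by
    rw [← Nat.cofinite_eq_atTop]; exact hyperfilter_le_cofinite
  have hR0 : 0 ≤ R := by
    have h1 := (norm_nonneg _).trans (hyR 0 0)
    simpa using h1
  have hlim : ∀ t, ∃ v, 0 ≤ t → Tendsto (fun n => y n (k n t)) U (𝓝 v) := by
    intro t
    by_cases ht : 0 ≤ t
    swap
    · exact ⟨0, fun h => absurd h ht⟩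
    have hmem : ∀ n, y n (k n t) ∈ Metric.closedBall x (R * t) := by
      intro n
      have h1 := hyL n 0 (k n t) (Nat.zero_le _)
      rw [hy0] at h1
      rw [Metric.mem_closedBall, dist_eq_norm]
      refine h1.trans (mul_le_mul_of_nonneg_left ?_ hR0)
      have h2 : (k n t : ℝ) ≤ t * ((n : ℝ) + 1) ^ 2 := Nat.floor_le (by positivity)
      have h3 := mul_le_mul_of_nonneg_right h2 (hh0 n).le
      have h4 : t * ((n : ℝ) + 1) ^ 2 * h n = t := by simp only [hh]; field_simp
      simp only [Nat.cast_zero, zero_mul, sub_zero]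
      linarith
    obtain ⟨v, -, hv⟩ := (isCompact_closedBall x (R * t)).ultrafilter_le_nhds
      (U.map fun n => y n (k n t)) (by
        rw [le_principal_iff]; exact Filter.Eventually.of_forall (f := U) hmem)
    exact ⟨v, fun _ => hv⟩
  choose γ hγ using hlim
  have hkU : ∀ t, 0 ≤ t → Tendsto (fun n => (k n t : ℝ) * h n) U (𝓝 t) :=
    fun t ht => (hkt t ht).mono_left hUle
  have hLip : ∀ s t, 0 ≤ s → s ≤ t → ‖γ t - γ s‖ ≤ R * (t - s) := by
    intro s t hs hst
    exact le_of_tendsto_of_tendsto ((hγ t (hs.trans hst)).sub (hγ s hs)).norm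
      (((hkU t (hs.trans hst)).sub (hkU s hs)).const_mul R)
      (Eventually.of_forall fun n => hyL n _ _ (hkmono n s t hst))
  refine ⟨γ, ?_, fun s t hs ht => ?_, fun s t hs hst p' C ρ hρ hC => ?_⟩
  · refine tendsto_nhds_unique (hγ 0 le_rfl) ?_
    simp [hk, hy0]
  · rcases le_total s t with hst | hst
    · rw [abs_of_nonneg (sub_nonneg.2 hst)]; exact hLip s t hs hst
    · rw [abs_of_nonpos (sub_nonpos.2 hst), norm_sub_rev, neg_sub]; exact hLip t s ht hst
  · have ht := hs.trans hst
    have hinv : Tendsto (fun n : ℕ => 1 / ((n : ℝ) + 1)) U (𝓝 0) :=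
      tendsto_one_div_add_atTop_nhds_zero_nat.mono_left hUle
    have e1 : ∀ n : ℕ, K ^ 2 / (2 * ((n : ℝ) + 1)) = K ^ 2 / 2 * (1 / ((n : ℝ) + 1)) := by
      intro n; field_simp
    have e2 : ∀ n : ℕ, 1 / ((n : ℝ) + 1) + ((n : ℝ) + 1) * (1 / ((n : ℝ) + 1) ^ 2) * R ^ 2 =
        (1 + R ^ 2) * (1 / ((n : ℝ) + 1)) := by
      intro n; field_simp
    have e3 : ∀ n : ℕ, K / (2 * ((n : ℝ) + 1)) = K / 2 * (1 / ((n : ℝ) + 1)) := by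
      intro n; field_simp
    have lim1 : Tendsto (fun n => f (y n (k n t)) - f (y n (k n s))) U
        (𝓝 (f (γ t) - f (γ s))) :=
      ((hf.tendsto _).comp (hγ t ht)).sub ((hf.tendsto _).comp (hγ s hs))
    have lim2 : Tendsto (fun n : ℕ => K ^ 2 / 2 * (1 / ((n : ℝ) + 1)) +
        inner ℝ p' (y n (k n t) - y n (k n s)) +
        ((k n t : ℝ) * h n - k n s * h n) * (C + (1 + R ^ 2) * (1 / ((n : ℝ) + 1)))) U
        (𝓝 (K ^ 2 / 2 * 0 + inner ℝ p' (γ t - γ s) + (t - s) * (C + (1 + R ^ 2) * 0))) :=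
      ((hinv.const_mul _).add (tendsto_const_nhds.inner ((hγ t ht).sub (hγ s hs)))).add
        (((hkU t ht).sub (hkU s hs)).mul (tendsto_const_nhds.add (hinv.const_mul _)))
    -- Controls the distance from `γ s` of the points where `F` is evaluated; the margin `ρ` absorbs
    -- the vanishing terms.
    have lim3 : Tendsto (fun n : ℕ => K / 2 * (1 / ((n : ℝ) + 1)) +
        R * ((k n t : ℝ) * h n - k n s * h n) + ‖y n (k n s) - γ s‖) U
        (𝓝 (K / 2 * 0 + R * (t - s) + ‖γ s - γ s‖)) :=
      ((hinv.const_mul _).add (((hkU t ht).sub (hkU s hs)).const_mul R)).add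
        ((hγ s hs).sub tendsto_const_nhds).norm
    have hev := lim3.eventually_le_const (show _ < R * (t - s) + ρ by simpa using hρ)
    have := le_of_tendsto_of_tendsto lim1 lim2 (hev.mono fun n hn => ?_)
    · simpa using this
    · have h1 := hyF n (k n s) (k n t) (hkmono n s t hst) p' C (fun z hz => by
        obtain ⟨j, hj1, hj2, hj3⟩ := hz
        apply hC
        rw [e3] at hj3
        have h2 := hyL n (k n s) j hj1
        have h3 := norm_sub_le_norm_sub_add_norm_sub z (y n j) (γ s)
        have h4 := norm_sub_le_norm_sub_add_norm_sub (y n j) (y n (k n s)) (γ s)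
        have h5 : (j : ℝ) * h n ≤ k n t * h n :=
          mul_le_mul_of_nonneg_right (by exact_mod_cast hj2.le) (hh0 n).le
        have h6 : R * ((j : ℝ) * h n - k n s * h n) ≤ R * ((k n t : ℝ) * h n - k n s * h n) :=
          mul_le_mul_of_nonneg_left (by linarith) hR0
        linarith)
      rw [e1, e2] at h1
      refine h1.trans (le_of_eq ?_)
      simp only [hh]
      ring

end Descent

/-! ### Derivative along a descent curve. -/

section Calibration

variable {E : Type*} [NormedAddCommGroup E] [InnerProductSpace ℝ E]

/-- Along a descent curve, the derivative of a subsolution is the Fenchel transform of the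
Hamiltonian at the velocity. -/
theorem isLUB_of_descent_curve [ProperSpace E] {f : E → ℝ} (hf : Continuous f) {B : ℝ}
    (hB : ∀ y, |f y| ≤ B) {K : ℝ} (hfK : ∀ x y, |f x - f y| ≤ K * ‖x - y‖)
    {F : E → E → ℝ} (hF : Continuous fun z : E × E => F z.1 z.2)
    (hsub : ∀ z p, IsProxSuper f z p → ‖p‖ ≤ K ∧ F z p ≤ 0) {R : ℝ} {γ : ℝ → E}
    (hdesc : ∀ s t, 0 ≤ s → s ≤ t → ∀ p' C ρ, 0 < ρ →
        (∀ z, ‖z - γ s‖ ≤ R * (t - s) + ρ → F z p' ≤ C) →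
        f (γ t) - f (γ s) ≤ inner ℝ p' (γ t - γ s) + (t - s) * C)
    {t : ℝ} (ht : 0 ≤ t) {w : E} {d : ℝ} (hγ : HasDerivAt γ w t)
    (hd : HasDerivAt (fun s => f (γ s)) d t) :
    IsLUB (range fun p => inner ℝ p (-w) - F (γ t) p) (-d) := by
  constructor
  · rintro _ ⟨p, rfl⟩
    suffices h : d ≤ inner ℝ p w + F (γ t) p by
      simp only [inner_neg_right]; linarith
    apply le_of_forall_pos_le_add
    intro e he
    have hFp : Continuous fun z => F z p := hF.comp (by fun_prop : Continuous fun z : E => (z, p))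
    obtain ⟨r, hr, hrF⟩ := Metric.continuous_iff.1 hFp (γ t) e he
    have hlim := hd.tendsto_slope_zero_right
    have hlimγ := hγ.tendsto_slope_zero_right
    have hRlim : Tendsto (fun s : ℝ => R * s + r / 2) (𝓝[>] 0) (𝓝 (R * 0 + r / 2)) :=
      ((tendsto_id.const_mul R).add_const _).mono_left nhdsWithin_le_nhds
    have hev := hRlim.eventually_lt_const (show R * 0 + r / 2 < r by linarith)
    refine le_of_tendsto_of_tendsto hlim
      (((tendsto_const_nhds (x := p)).inner hlimγ).add_const (F (γ t) p + e)) ?_ |>.trans_eq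
      (by ring)
    filter_upwards [hev, self_mem_nhdsWithin] with s hs hs0
    have hs0 : 0 < s := hs0
    have h1 := hdesc t (t + s) ht (by linarith) p (F (γ t) p + e) (r / 2) (by positivity)
      (fun z hz => by
        rw [add_sub_cancel_left] at hz
        have := hrF z (by rw [dist_eq_norm]; linarith)
        rw [Real.dist_eq] at this
        linarith [(abs_lt.1 this).2])
    rw [add_sub_cancel_left] at h1
    have h2 := mul_le_mul_of_nonneg_left h1 (inv_nonneg.2 hs0.le)
    rw [smul_eq_mul, real_inner_smul_right]
    rwa [mul_add, inv_mul_cancel_left₀ hs0.ne'] at h2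
  · intro l hl
    have hl' : ∀ p, inner ℝ p (-w) - F (γ t) p ≤ l := fun p => hl ⟨p, rfl⟩
    rw [neg_le]
    apply le_of_forall_pos_le_add
    intro e he
    -- Supergradients at nearby points lie in this compact ball and satisfy `F z p ≤ 0`; hence `F (γ
    -- t) p < e`, and their slope along `-w` is at most `l + e`.
    have hunif : ∀ᶠ z in 𝓝 (γ t), ∀ p ∈ Metric.closedBall (0 : E) K, F (γ t) p - e < F z p := by
      refine (isCompact_closedBall (0 : E) K).eventually_forall_of_forall_eventually fun p _ => ?_
      have hG : Continuous fun z : E × E => F z.1 z.2 - (F (γ t) z.2 - e) :=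
        hF.sub ((hF.comp (by fun_prop : Continuous fun z : E × E => (γ t, z.2))).sub
          continuous_const)
      have := hG.continuousAt (x := (γ t, p)) |>.eventually_const_lt
        (show 0 < F (γ t, p).1 (γ t, p).2 - (F (γ t) (γ t, p).2 - e) by simp [he])
      exact this.mono fun z hz => by linarith
    obtain ⟨r, hr, hrF⟩ := Metric.eventually_nhds_iff.1 hunif
    have hlim := hd.tendsto_slope_zero_left
    have hlimγ := ((hγ.tendsto_slope_zero_left.sub_const w).norm.const_mul K).const_sub (-(l + e))
    have hwlim : Tendsto (fun s : ℝ => -s * ‖w‖ + r / 2) (𝓝[<] 0) (𝓝 (-0 * ‖w‖ + r / 2)) :=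
      ((tendsto_id.neg.mul_const _).add_const _).mono_left nhdsWithin_le_nhds
    have hev := hwlim.eventually_lt_const (show -0 * ‖w‖ + r / 2 < r by simp [hr])
    have key := le_of_tendsto_of_tendsto hlimγ hlim ?_
    · simp only [sub_self, norm_zero, mul_zero, sub_zero] at key
      linarith
    filter_upwards [hev, self_mem_nhdsWithin] with s hs hs0
    have hs0 : s < 0 := hs0
    -- For `s < 0` the curve is replaced by its tangent line `γ t + s • w`; the Lipschitz bound
    -- makes the discrepancy `o(s)`.
    have h1 := sub_le_of_proxSuper_slope_le hf hB (γ t) (-w) (C := l + e) (δ := -s) (ρ := r / 2)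
      (by linarith) (by positivity) (fun z p ⟨a, ha, hz⟩ hp => by
        obtain ⟨hp1, hp2⟩ := hsub z p hp
        have h2 : dist z (γ t) < r := by
          rw [dist_eq_norm]
          have h3 := norm_add_le (z - (γ t + a • -w)) (a • -w)
          rw [show z - (γ t + a • -w) + a • -w = z - γ t by abel, norm_smul, norm_neg,
            Real.norm_of_nonneg ha.1] at h3
          have h4 : a * ‖w‖ ≤ -s * ‖w‖ := mul_le_mul_of_nonneg_right ha.2 (norm_nonneg _)
          linarith
        have h5 := hrF h2 p (by simpa using hp1)
        linarith [hl' p])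
    rw [smul_neg, neg_smul, neg_neg] at h1
    have h2 := (abs_le.1 (hfK (γ (t + s)) (γ t + s • w))).2
    have h3 : γ (t + s) - (γ t + s • w) = s • (s⁻¹ • (γ (t + s) - γ t) - w) := by
      rw [smul_sub, smul_inv_smul₀ hs0.ne]; abel
    rw [h3, norm_smul, Real.norm_of_nonpos hs0.le] at h2
    have h4 : f (γ (t + s)) - f (γ t) ≤
        s * (-(l + e) - K * ‖s⁻¹ • (γ (t + s) - γ t) - w‖) := by linarith
    rw [smul_eq_mul, inv_mul_eq_div, le_div_iff_of_neg hs0]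
    linarith

end Calibration

/-! ### Coercivity uniform in the base point. -/

section Coercivity

/-- Sublevel sets of a continuous family of convex superlinear functions with compact parameter
space are uniformly bounded. -/
theorem exists_norm_le_of_le {X : Type*} [TopologicalSpace X] [CompactSpace X] {N : ℕ}
    {H : X → RSpace N → ℝ} (hc : Continuous fun z : X × RSpace N => H z.1 z.2)
    (hconv : ∀ x, ConvexOn ℝ univ (H x)) (hs : ∀ x, Superlinear (H x)) (M : ℝ) :
    ∃ K, ∀ x p, H x p ≤ M → ‖p‖ ≤ K := by
  obtain ⟨M0, hM0⟩ := (isCompact_univ (X := X)).bddAbove_image (f := fun x => H x 0)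
    (hc.comp (by fun_prop : Continuous fun x : X => (x, (0 : RSpace N)))).continuousOn
  have hM0' : ∀ x, H x 0 ≤ M0 := fun x => hM0 ⟨x, mem_univ _, rfl⟩
  set M' := max M M0 with hM'
  suffices h : ∃ K, ∀ x ∈ (univ : Set X), ∀ p, H x p ≤ M → ‖p‖ ≤ K by simpa using h
  refine isCompact_univ.induction_on
    (p := fun s : Set X => ∃ K, ∀ x ∈ s, ∀ p, H x p ≤ M → ‖p‖ ≤ K)
    ⟨0, by simp⟩ (fun s t hst ⟨K, hK⟩ => ⟨K, fun x hx => hK x (hst hx)⟩)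
    (fun s t ⟨K, hK⟩ ⟨K', hK'⟩ => ⟨max K K', ?_⟩) (fun x _ => ?_)
  · rintro x (hx | hx) p hp
    · exact (hK x hx p hp).trans (le_max_left _ _)
    · exact (hK' x hx p hp).trans (le_max_right _ _)
  · have h1 := (hs x).eventually_ge_atTop (|M'| + 1)
    rw [← comap_norm_atTop, eventually_comap, eventually_atTop] at h1
    obtain ⟨r0, hr0⟩ := h1
    set r := max r0 1 with hr
    have hr1 : 1 ≤ r := le_max_right _ _
    have hsph : ∀ p ∈ Metric.sphere (0 : RSpace N) r, M' < H x p := by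
      intro p hp
      rw [mem_sphere_zero_iff_norm] at hp
      have h2 := hr0 r (le_max_left _ _) p hp
      rw [hp, le_div_iff₀ (by linarith)] at h2
      have h3 : (|M'| + 1) * 1 ≤ (|M'| + 1) * r := by gcongr
      linarith [le_abs_self M']
    -- The strict bound on a compact sphere persists for nearby `z`. Convexity along the ray from
    -- `0`, where `H z 0 ≤ M'`, then excludes `H z p ≤ M` beyond the sphere.
    have hnear : ∀ᶠ z in 𝓝 x, ∀ p ∈ Metric.sphere (0 : RSpace N) r, M' < H z p :=
      (isCompact_sphere _ _).eventually_forall_of_forall_eventually fun p hp =>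
        hc.continuousAt (x := (x, p)) |>.eventually_const_lt (hsph p hp)
    refine ⟨_, mem_nhdsWithin_of_mem_nhds hnear, r, fun z hz p hp => ?_⟩
    by_contra! hlt
    have hp0 : 0 < ‖p‖ := by linarith
    have h2 := hz ((r / ‖p‖) • p) (by
      rw [mem_sphere_zero_iff_norm, norm_smul, Real.norm_of_nonneg (by positivity)]
      field_simp)
    have hle : r / ‖p‖ ≤ 1 := by rw [div_le_one hp0]; exact hlt.le
    have h3 := (hconv z).2 (mem_univ 0) (mem_univ p) (sub_nonneg.2 hle)
      (show 0 ≤ r / ‖p‖ by positivity) (by ring)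
    rw [smul_zero, zero_add, smul_eq_mul, smul_eq_mul] at h3
    have h4 := mul_le_mul_of_nonneg_left ((hM0' z).trans (le_max_right M M0)) (sub_nonneg.2 hle)
    have h5 := mul_le_mul_of_nonneg_left (hp.trans (le_max_left M M0))
      (show 0 ≤ r / ‖p‖ by positivity)
    linarith

end Coercivity

/-! ### Passage between the torus and its universal cover. -/

section TorusLift

variable {N : ℕ}

theorem continuous_torusProj : Continuous (torusProj : RSpace N → Torus N) :=
  continuous_pi fun k => (AddCircle.continuous_mk' 1).comp (by fun_prop)

theorem torusProj_add (v w : RSpace N) : torusProj (v + w) = torusProj v + torusProj w := by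
  ext k; simp [torusProj]

theorem torusProj_surjective : Function.Surjective (torusProj : RSpace N → Torus N) := by
  intro x
  choose v hv using fun k => QuotientAddGroup.mk_surjective (x k)
  exact ⟨WithLp.toLp 2 v, funext fun k => hv k⟩

theorem lipschitzWith_torusProj : LipschitzWith 1 (torusProj : RSpace N → Torus N) := by
  refine LipschitzWith.of_dist_le_mul fun v w => ?_
  rw [NNReal.coe_one, one_mul, dist_pi_le_iff dist_nonneg]
  intro k
  rw [dist_eq_norm, dist_eq_norm]
  calc ‖((v k : ℝ) : UnitAddCircle) - ((w k : ℝ) : UnitAddCircle)‖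
      = ‖((v k - w k : ℝ) : UnitAddCircle)‖ := rfl
    _ ≤ ‖v k - w k‖ := QuotientAddGroup.norm_mk_le_norm
    _ ≤ ‖v - w‖ := PiLp.norm_apply_le (v - w) k

theorem contDiff_quadratic (a c : ℝ) (p : RSpace N) :
    ContDiff ℝ 1 fun h : RSpace N => a + inner ℝ p h + c * ‖h‖ ^ 2 :=
  (contDiff_const.add (contDiff_const.inner ℝ contDiff_id)).add
    (contDiff_const.mul (contDiff_norm_sq ℝ))

theorem hasGradientAt_quadratic (a c : ℝ) (p : RSpace N) :
    HasGradientAt (fun h : RSpace N => a + inner ℝ p h + c * ‖h‖ ^ 2) p 0 := by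
  rw [hasGradientAt_iff_hasFDerivAt]
  have h1 : HasFDerivAt (fun h : RSpace N => ‖h‖ ^ 2) (2 • (innerSL ℝ (0 : RSpace N))) 0 :=
    (hasStrictFDerivAt_norm_sq 0).hasFDerivAt
  have h2 : HasFDerivAt (fun h : RSpace N => (inner ℝ p h : ℝ)) (innerSL ℝ p) 0 :=
    (innerSL ℝ p).hasFDerivAt
  refine ((h2.const_add a).add (h1.const_mul c)).congr_fderiv ?_
  ext v
  simp

/-- The quadratic majorant, recentred at `z`, is itself a `C¹` test function; this links viscosity
inequalities to proximal calculus. -/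
theorem IsProxSuper.mem_superDiff {f : Torus N → ℝ} {z p : RSpace N}
    (h : IsProxSuper (fun v => f (torusProj v)) z p) : p ∈ superDiff f (torusProj z) := by
  obtain ⟨c, hc⟩ := h
  refine ⟨_, contDiff_quadratic (f (torusProj z)) c p, by simp, Eventually.of_forall fun v => ?_,
    hasGradientAt_quadratic _ c p⟩
  have := hc (z + v)
  simpa [torusProj_add] using this

theorem IsProxSub.mem_subDiff {f : Torus N → ℝ} {z p : RSpace N}
    (h : IsProxSub (fun v => f (torusProj v)) z p) : p ∈ subDiff f (torusProj z) := by
  obtain ⟨c, hc⟩ := h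
  refine ⟨_, contDiff_quadratic (f (torusProj z)) (-c) p, by simp,
    Eventually.of_forall fun v => ?_, hasGradientAt_quadratic _ (-c) p⟩
  have := hc (z + v)
  simp only [torusProj_add, add_sub_cancel_left] at this
  linarith

end TorusLift

/-! ### The scalar equation, then the system. -/

/-- Every viscosity solution on the torus of a scalar Hamilton-Jacobi equation with continuous,
convex and superlinear Hamiltonian admits a Lipschitz backward calibrated curve from each point. -/
theorem exists_calibrated_lift {N : ℕ} {f : Torus N → ℝ} {F : Torus N → RSpace N → ℝ}
    (hF : Continuous fun z : Torus N × RSpace N => F z.1 z.2)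
    (hconv : ∀ x, ConvexOn ℝ univ (F x)) {K : ℝ} (hK : ∀ x p, F x p ≤ 0 → ‖p‖ ≤ K)
    (hf : Continuous f) (hsub : ∀ x, ∀ p ∈ superDiff f x, F x p ≤ 0)
    (hsup : ∀ x, ∀ p ∈ subDiff f x, 0 ≤ F x p) (x : RSpace N) :
    ∃ (γ : ℝ → RSpace N) (R C : NNReal), γ 0 = x ∧ LipschitzWith R γ ∧
      LipschitzWith C (fun t => f (torusProj (γ t))) ∧
      ∀ t < 0, ∀ w d, HasDerivAt γ w t → HasDerivAt (fun s => f (torusProj (γ s))) d t →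
        IsLUB (range fun p => inner ℝ p w - F (torusProj (γ t)) p) d := by
  set f' : RSpace N → ℝ := fun v => f (torusProj v) with hf'
  set F' : RSpace N → RSpace N → ℝ := fun v => F (torusProj v) with hF'
  set K' := max K 0 with hK'
  have hK'0 : 0 ≤ K' := le_max_right _ _
  have hfc : Continuous f' := hf.comp continuous_torusProj
  have hFc : Continuous fun z : RSpace N × RSpace N => F' z.1 z.2 :=
    hF.comp ((continuous_torusProj.comp continuous_fst).prodMk continuous_snd)
  obtain ⟨B, hB⟩ := isCompact_univ.exists_bound_of_continuousOn hf.continuousOn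
  have hB' : ∀ y, |f' y| ≤ B := fun y => hB _ (mem_univ _)
  have hsub' : ∀ z p, IsProxSuper f' z p → ‖p‖ ≤ K' ∧ F' z p ≤ 0 := fun z p hp => by
    have h1 := hsub _ _ hp.mem_superDiff
    exact ⟨(hK _ _ h1).trans (le_max_left _ _), h1⟩
  have hfK := abs_sub_le_of_proxSuper_norm_le hfc hB' (K := K') fun z p hp => (hsub' z p hp).1
  -- Radius `K' + 1` covers the unit ball around every proximal subgradient, as
  -- `exists_approx_subgradient` requires.
  obtain ⟨M, hM⟩ := (isCompact_univ.prod (isCompact_closedBall (0 : RSpace N) (K' + 1))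
    ).exists_bound_of_continuousOn hF.continuousOn
  have hM' : ∀ v p, ‖p‖ ≤ K' + 1 → |F' v p| ≤ M := fun v p hp =>
    hM (torusProj v, p) ⟨mem_univ _, by simpa using hp⟩
  obtain ⟨γ, hγ0, hγL, hγd⟩ := exists_descent_curve hfc hB' hK'0 hfK (F := F') (R := 2 * M + 1)
    (fun z p hp e he he1 => exists_approx_subgradient (hconv _)
      (hF.comp (by fun_prop : Continuous fun p : RSpace N => (torusProj z, p)))
      (fun p' hp' => hM' z p' (by
        have h1 := hp.norm_le hK'0 hfK
        have h2 := norm_le_norm_add_norm_sub' p' p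
        linarith))
      (hsup _ _ hp.mem_subDiff) he he1) x
  have hM0 : 0 ≤ M := (abs_nonneg _).trans (hM' 0 0 (by simp; positivity))
  -- Time reversal; freezing the curve at positive times makes it Lipschitz on all of `ℝ`.
  set Γ : ℝ → RSpace N := fun t => γ (max (-t) 0) with hΓ
  have hΓL : ∀ s t, dist (Γ s) (Γ t) ≤ (2 * M + 1) * dist s t := by
    intro s t
    rw [dist_eq_norm, dist_eq_norm]
    refine (hγL _ _ (le_max_right _ _) (le_max_right _ _)).trans ?_
    gcongr
    refine (abs_max_sub_max_le_abs _ _ _).trans_eq ?_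
    rw [Real.norm_eq_abs, abs_sub_comm, neg_sub_neg, abs_sub_comm]
  refine ⟨Γ, ⟨2 * M + 1, by positivity⟩, ⟨K' * (2 * M + 1), by positivity⟩, by simp [hΓ, hγ0],
    LipschitzWith.of_dist_le_mul hΓL, LipschitzWith.of_dist_le_mul fun s t => ?_,
    fun t ht w d hw hd => ?_⟩
  · refine (hfK _ _).trans ?_
    rw [← dist_eq_norm]
    exact (mul_le_mul_of_nonneg_left (hΓL s t) hK'0).trans_eq (mul_assoc _ _ _).symm
  · have hev : ∀ᶠ s in 𝓝 (-t), γ s = Γ (-s) := by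
      filter_upwards [eventually_gt_nhds (show 0 < -t by linarith)] with s hs
      simp [hΓ, hs.le]
    have hneg : HasDerivAt (fun s : ℝ => -s) (-1) (-t) := hasDerivAt_neg _
    have h1 : HasDerivAt γ (-w) (-t) := by
      have := HasDerivAt.scomp (-t) (by rwa [neg_neg] : HasDerivAt Γ w (- -t)) hneg
      rw [neg_one_smul] at this
      exact this.congr_of_eventuallyEq hev
    have h2 : HasDerivAt (fun s => f' (γ s)) (-d) (-t) := by
      have := HasDerivAt.scomp (-t)
        (by rwa [neg_neg] : HasDerivAt (fun s => f (torusProj (Γ s))) d (- -t)) hneg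
      rw [neg_one_smul] at this
      exact this.congr_of_eventuallyEq (hev.mono fun s hs => by simp [hf', hs])
    have h3 := isLUB_of_descent_curve hfc hB' hfK hFc hsub' hγd (by linarith) h1 h2
    have h4 : γ (-t) = Γ t := by simp [hΓ, ht.le]
    simpa only [neg_neg, h4] using h3

theorem proposition4p4 {N m : ℕ}
    (H : Fin m → Torus N → RSpace N → ℝ)
    (hH_cont : ∀ i, Continuous (fun z : Torus N × RSpace N => H i z.1 z.2))
    (hH_conv : ∀ i x, ConvexOn ℝ Set.univ (H i x))
    (hH_super : ∀ i x, Superlinear (H i x))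
    (A : Matrix (Fin m) (Fin m) ℝ)
    (hA_off : ∀ i j, i ≠ j → A i j ≤ 0)
    (hA_sum : ∀ i, ∑ j, A i j = 0)
    (hA_irred : ∀ W : Set (Fin m), W.Nonempty → W ≠ Set.univ → ∃ i ∈ W, ∃ j ∉ W, A i j < 0)
    (u : Torus N → Fin m → ℝ) (hu : IsCriticalSolution H A u)
    (x : Torus N) (i : Fin m) :
    ∃ (γ : ℝ → Torus N) (v : ℝ → RSpace N),
      IsACCurve γ ∧ γ 0 = x ∧
      (∀ᵐ t ∂(volume.restrict (Set.Iio (0 : ℝ))),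
        HasVelocityAt γ (v t) t ∧
        HasDerivAt (fun s => u (γ s) i) (calibrationIntegrand H A u i (γ t) (v t)) t) ∧
      (∀ a b : ℝ, a ≤ b → b ≤ 0 →
        IntervalIntegrable (fun t => calibrationIntegrand H A u i (γ t) (v t)) volume a b ∧
        u (γ b) i - u (γ a) i = ∫ t in a..b, calibrationIntegrand H A u i (γ t) (v t)) := by
  obtain ⟨⟨hc, hsub⟩, -, hsup⟩ := hu
  set β := criticalValue H A with hβ
  set V : Torus N → ℝ := fun y => ∑ j, A i j * u y j - β with hV
  have hVc : Continuous V := by fun_prop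
  obtain ⟨B, hB⟩ := isCompact_univ.exists_bound_of_continuousOn hVc.continuousOn
  obtain ⟨K, hK⟩ := exists_norm_le_of_le (hH_cont i) (hH_conv i) (hH_super i) B
  obtain ⟨x₀, hx₀⟩ := torusProj_surjective x
  obtain ⟨γ, R, C, hγ0, hγL, hfL, hcal⟩ := exists_calibrated_lift (f := fun y => u y i)
    (F := fun y p => H i y p + V y) (K := K) ((hH_cont i).add (hVc.comp continuous_fst))
    (fun y => (hH_conv i y).add_const _)
    (fun y p hp => hK y p (by linarith [(abs_le.1 (hB y (mem_univ _))).1]))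
    (by fun_prop) (fun y p hp => by linarith [hsub y i p hp])
    (fun y p hp => by linarith [hsup y i p hp]) x₀
  have hderiv : ∀ᵐ t : ℝ, t < 0 → HasDerivAt γ (deriv γ t) t ∧
      HasDerivAt (fun s => u (torusProj (γ s)) i)
        (calibrationIntegrand H A u i (torusProj (γ t)) (deriv γ t)) t := by
    filter_upwards [hγL.ae_differentiableAt_real, hfL.ae_differentiableAt_real] with t h1 h2 ht
    refine ⟨h1.hasDerivAt, ?_⟩
    have h3 := hcal t ht _ _ h1.hasDerivAt h2.hasDerivAt
    -- Moving `V`, which does not depend on `p`, out of the supremum leaves the Lagrangian of `H i`.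
    have h4 : IsLUB (range fun p => inner ℝ p (deriv γ t) - H i (torusProj (γ t)) p)
        (deriv (fun s => u (torusProj (γ s)) i) t + V (torusProj (γ t))) := by
      refine ⟨?_, fun l hl => ?_⟩
      · rintro _ ⟨p, rfl⟩
        have := h3.1 ⟨p, rfl⟩
        simp only at this ⊢
        linarith
      · have := h3.2 (show l - V (torusProj (γ t)) ∈ upperBounds _ by
          rintro _ ⟨p, rfl⟩
          have := hl ⟨p, rfl⟩
          simp only at this ⊢
          linarith)
        linarith
    have h5 : calibrationIntegrand H A u i (torusProj (γ t)) (deriv γ t) =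
        deriv (fun s => u (torusProj (γ s)) i) t := by
      simp only [calibrationIntegrand, lagrangian, h4.ciSup_eq, hV]
      ring
    exact h5 ▸ h2.hasDerivAt
  refine ⟨fun t => torusProj (γ t), deriv γ, fun a _ =>
    ((lipschitzWith_torusProj.comp hγL).lipschitzOnWith).absolutelyContinuousOnInterval,
    by simp [hγ0, hx₀], ?_, fun a b hab hb => ?_⟩
  · rw [ae_restrict_iff' measurableSet_Iio]
    filter_upwards [hderiv] with t h ht
    exact ⟨⟨γ, Eventually.of_forall fun _ => rfl, (h ht).1⟩, (h ht).2⟩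
  · have hac := (hfL.lipschitzOnWith (s := uIcc a b)).absolutelyContinuousOnInterval
    have hae : ∀ᵐ t : ℝ, t ∈ uIoc a b → deriv (fun s => u (torusProj (γ s)) i) t =
        calibrationIntegrand H A u i (torusProj (γ t)) (deriv γ t) := by
      -- When `b = 0` the interval contains time `0`, which `hderiv` does not cover; it is a null
      -- set.
      filter_upwards [hderiv, Measure.ae_ne volume (0 : ℝ)] with t h h0 ht
      rw [uIoc_of_le hab] at ht
      exact (h (lt_of_le_of_ne (ht.2.trans hb) h0)).2.deriv
    refine ⟨hac.intervalIntegrable_deriv.congr_ae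
      ((ae_restrict_iff' measurableSet_uIoc).2 hae), ?_⟩
    rw [← intervalIntegral.integral_congr_ae hae, hac.integral_deriv_eq_sub]
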